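/- Let $k$ be a field, and let $H$ be a finite group acting by automorphisms on a group $\Gamma$. The smash coproduct $k[\Gamma]\rtimes k^H$ is the Hopf algebra which is $k[\Gamma]\otimes k^H$ as an algebra ($k[\Gamma]$ is the group algebra, $k^H$ the algebra of functions $H\to k$ with basis of indicator functions $(\delta_h)_{h\in H}$, and $r\#f$ denotes $r\otimes f$), with $$\Delta(r\#\delta_h)=\sum_{l\in H} r\#\delta_l\otimes l^{-1}.r\#\delta_{l^{-1}h},\qquad \varepsilon(r\#\delta_h)=\delta_{h,1},\qquad S(r\#\delta_h)=h^{-1}.r^{-1}\#\delta_{h^{-1}}.$$ A quotient datum is a triple $(G,N,\Phi)$ where $G\subset H$ is a subgroup, $N\triangleleft\Gamma$ is a normal $G$-stable subgroup, and $\Phi:N\to(k^G)^\times$ is a group morphism with $\Phi(r)(lh)=\Phi(l^{-1}.r)(h)\,\Phi(r)(l)$ and $\Phi(r)=\Phi(srs^{-1})$ for all $r\in N$, $s\in\Gamma$, $h,l\in G$. Let $u:\Gamma\to\Gamma/N$ be the canonical projection and $j:\Gamma/N\to\Gamma$ a section of $u$ with $j(u(1))=1$. Then $k[\Gamma/N]\rtimes_\Phi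 k^G$ denotes the Hopf algebra with underlying space $k[\Gamma/N]\otimes k^G$, unit $1\#1$, counit $\varepsilon(u(r)\#\delta_h)=\delta_{h,1}$, and $$(u(r)\#\delta_h)(u(s)\#\delta_g)=u(rs)\#\delta_h\delta_g\,\Phi\big(ju(r)\,ju(s)\,ju(rs)^{-1}\big),$$ $$\Delta(u(r)\#\delta_h)=\sum_{l\in G}\big(u(r)\#\delta_{l^{-1}}\big)\otimes \big(u(l.r)\#\delta_{lh}\,\Phi(l.ju(r)\;ju(l.r)^{-1})\big),$$ $$S(u(r)\#\delta_h)=u(h^{-1}.r^{-1})\#\Phi\big(ju(h^{-1}.r^{-1})^{-1}\;h^{-1}.ju(r)^{-1}\big)\delta_{h^{-1}};$$ up to isomorphism it does not depend on $j$. **Proposition 2.6.** Let $L$ be a Hopf algebra over $k$ and let $\pi:k[\Gamma]\rtimes k^H\to L$ be a surjective Hopf algebra map whose restriction to $k^H$, that is, the map $f\mapsto\pi(1\#f)$, is injective. Then there exists a quotient datum $(H,N,\Phi)$ (with $G=H$) such that $L$ is isomorphic, as a Hopf algebra, to $k[\Gamma/N]\rtimes_\Phi k^H$ (for every choice of $j$).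 More precisely, $$N=\{r\in\Gamma\mid \exists f\in(k^H)^\times,\ \pi(r\#1)=\pi(1\#f)\},$$ and for $r\in N$, $\Phi(r)$ is the unique $f\in(k^H)^\times$ such that $\pi(r\#1)=\pi(1\#f)$. -/

import Mathlib

open scoped TensorProduct

noncomputable section

attribute [local instance] Fintype.ofFinite

/-! ### The smash coproduct -/

/-- The underlying space `k[Γ] ⊗ k^H` of the smash coproduct of the group algebra `k[Γ]` by the
algebra `k^H` of functions on `H`. It is a type synonym, because its coalgebra structure
is not the tensor product one. -/
def SmashCoproduct (k Γ H : Type*) [Field k] [Group Γ] : Type _ :=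
  MonoidAlgebra k Γ ⊗[k] (H → k)

namespace SmashCoproduct

variable {k Γ H : Type*} [Field k] [Group Γ]

/-- As an algebra the smash coproduct is the tensor product `k[Γ] ⊗ k^H`. -/
instance : Ring (SmashCoproduct k Γ H) :=
  inferInstanceAs (Ring (MonoidAlgebra k Γ ⊗[k] (H → k)))

instance : Algebra k (SmashCoproduct k Γ H) :=
  inferInstanceAs (Algebra k (MonoidAlgebra k Γ ⊗[k] (H → k)))

/-- The element `r # f = r ⊗ f`, for `r ∈ Γ` and `f ∈ k^H`. -/
def tmul (r : Γ) (f : H → k) : SmashCoproduct k Γ H :=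
  (MonoidAlgebra.of k Γ r ⊗ₜ[k] f : MonoidAlgebra k Γ ⊗[k] (H → k))

theorem tmul_mul_tmul (r s : Γ) (f g : H → k) : tmul r f * tmul s g = tmul (r * s) (f * g) := by
  have : MonoidAlgebra.of k Γ (r * s) = MonoidAlgebra.of k Γ r * MonoidAlgebra.of k Γ s :=
    map_mul _ _ _
  unfold tmul
  rw [this]
  exact Algebra.TensorProduct.tmul_mul_tmul _ _ _ _

theorem one_def : (1 : SmashCoproduct k Γ H) = tmul 1 1 := by
  unfold tmul
  rw [map_one]
  rfl

/-- The basis of the elements `r # δ_h`. -/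
def basis (k Γ H : Type*) [Field k] [Group Γ] [Finite H] :
    Module.Basis (Γ × H) k (SmashCoproduct k Γ H) :=
  (MonoidAlgebra.basis Γ k).tensorProduct (Pi.basisFun k H)

theorem basis_apply [Finite H] [DecidableEq H] (r : Γ) (h : H) :
    basis k Γ H (r, h) = tmul r (Pi.single h 1) := by
  simp only [basis, tmul]
  refine (Module.Basis.tensorProduct_apply _ _ _ _).trans ?_
  rw [Pi.basisFun_apply]
  congr 1

theorem tmul_eq_sum [Finite H] (r : Γ) (f : H → k) :
    tmul r f = ∑ h, f h • basis k Γ H (r, h) := by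
  classical
  have h1 : f = ∑ h, f h • (Pi.single h 1 : H → k) := by
    ext x; simp [Finset.sum_apply, Pi.single_apply]
  simp only [basis_apply]
  conv_lhs => rw [h1]
  unfold tmul
  rw [TensorProduct.tmul_sum]
  exact Finset.sum_congr rfl fun h _ => TensorProduct.tmul_smul _ _ _

theorem basis_mul_basis [Finite H] [DecidableEq H] (p q : Γ × H) :
    basis k Γ H p * basis k Γ H q =
      if p.2 = q.2 then basis k Γ H (p.1 * q.1, p.2) else 0 := by
  obtain ⟨r, h⟩ := p
  obtain ⟨s, g⟩ := q
  rw [basis_apply, basis_apply, tmul_mul_tmul]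
  dsimp only
  split_ifs with hg
  · subst hg
    rw [basis_apply, ← Pi.single_mul, one_mul]
  · have : (Pi.single h 1 : H → k) * Pi.single g 1 = 0 := by
      ext x
      simp only [Pi.mul_apply, Pi.single_apply, Pi.zero_apply]
      split_ifs with h1 h2 <;> simp_all
    rw [this]
    exact TensorProduct.tmul_zero _ _

theorem one_eq_sum [Finite H] : (1 : SmashCoproduct k Γ H) = ∑ h, basis k Γ H (1, h) := by
  rw [one_def, tmul_eq_sum]; simp

variable [Group H] [Finite H] [MulDistribMulAction H Γ]

/-- The comultiplication: `Δ(r # δ_h) = ∑ l, (r # δ_l) ⊗ (l⁻¹.r # δ_{l⁻¹h})`. -/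
def comulMap (k Γ H : Type*) [Field k] [Group Γ] [Group H] [Finite H] [MulDistribMulAction H Γ] :
    SmashCoproduct k Γ H →ₗ[k] SmashCoproduct k Γ H ⊗[k] SmashCoproduct k Γ H :=
  (basis k Γ H).constr k fun p =>
    ∑ l : H, basis k Γ H (p.1, l) ⊗ₜ[k] basis k Γ H (l⁻¹ • p.1, l⁻¹ * p.2)

open Classical in
/-- The counit: `ε(r # δ_h) = δ_{h,1}`. -/
def counitMap (k Γ H : Type*) [Field k] [Group Γ] [Group H] [Finite H] :
    SmashCoproduct k Γ H →ₗ[k] k :=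
  (basis k Γ H).constr k fun p => if p.2 = 1 then 1 else 0

/-- The antipode: `S(r # δ_h) = h⁻¹.r⁻¹ # δ_{h⁻¹}`. -/
def antipodeMap (k Γ H : Type*) [Field k] [Group Γ] [Group H] [Finite H]
    [MulDistribMulAction H Γ] : SmashCoproduct k Γ H →ₗ[k] SmashCoproduct k Γ H :=
  (basis k Γ H).constr k fun p => basis k Γ H (p.2⁻¹ • p.1⁻¹, p.2⁻¹)

theorem comulMap_basis (p : Γ × H) : comulMap k Γ H (basis k Γ H p) =
    ∑ l : H, basis k Γ H (p.1, l) ⊗ₜ[k] basis k Γ H (l⁻¹ • p.1, l⁻¹ * p.2) :=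
  Module.Basis.constr_basis _ _ _ _

open Classical in
theorem counitMap_basis {H : Type*} [Group H] [Finite H] (p : Γ × H) :
    counitMap k Γ H (basis k Γ H p) = if p.2 = 1 then 1 else 0 :=
  Module.Basis.constr_basis _ _ _ _

theorem antipodeMap_basis (p : Γ × H) :
    antipodeMap k Γ H (basis k Γ H p) = basis k Γ H (p.2⁻¹ • p.1⁻¹, p.2⁻¹) :=
  Module.Basis.constr_basis _ _ _ _

instance : Coalgebra k (SmashCoproduct k Γ H) where
  comul := comulMap k Γ H
  counit := counitMap k Γ H
  coassoc := by
    refine (basis k Γ H).ext fun p => ?_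
    simp only [LinearMap.comp_apply, comulMap_basis, map_sum, LinearMap.rTensor_tmul,
      LinearMap.lTensor_tmul, TensorProduct.sum_tmul, TensorProduct.tmul_sum,
      LinearEquiv.coe_coe, TensorProduct.assoc_tmul]
    rw [Finset.sum_comm]
    refine Finset.sum_congr rfl fun m _ => ?_
    refine Fintype.sum_equiv (Equiv.mulLeft m⁻¹) _ _ fun l => ?_
    simp [mul_smul, mul_assoc]
  rTensor_counit_comp_comul := by
    classical
    refine (basis k Γ H).ext fun p => ?_
    simp only [LinearMap.comp_apply, comulMap_basis, map_sum, LinearMap.rTensor_tmul,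
      counitMap_basis, TensorProduct.mk_apply]
    rw [Finset.sum_eq_single 1] <;> simp +contextual
  lTensor_counit_comp_comul := by
    classical
    refine (basis k Γ H).ext fun p => ?_
    simp only [LinearMap.comp_apply, comulMap_basis, map_sum, LinearMap.lTensor_tmul,
      counitMap_basis, TensorProduct.mk_apply, LinearMap.flip_apply]
    rw [Finset.sum_eq_single p.2]
    · simp
    · intro b _ hb
      rw [if_neg, TensorProduct.tmul_zero]
      rw [inv_mul_eq_one]
      exact hb
    · simp

instance : Bialgebra k (SmashCoproduct k Γ H) where
  counit_one := by
    classical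
    change counitMap k Γ H 1 = 1
    simp [one_eq_sum, counitMap_basis]
  mul_compr₂_counit := by
    classical
    refine (basis k Γ H).ext fun p => (basis k Γ H).ext fun q => ?_
    change counitMap k Γ H (_ * _) = counitMap k Γ H _ * counitMap k Γ H _
    rw [basis_mul_basis, counitMap_basis, counitMap_basis]
    by_cases h : p.2 = q.2
    · rw [if_pos h, counitMap_basis]
      simp [h]
    · rw [if_neg h, map_zero]
      by_cases h1 : p.2 = 1
      · have h2 : q.2 ≠ 1 := fun h2 => h (h1.trans h2.symm)
        simp [h2]
      · simp [h1]
  comul_one := by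
    change comulMap k Γ H 1 = 1
    rw [Algebra.TensorProduct.one_def, one_eq_sum, map_sum, TensorProduct.sum_tmul]
    simp only [comulMap_basis, TensorProduct.tmul_sum]
    rw [Finset.sum_comm]
    refine Finset.sum_congr rfl fun l _ => ?_
    refine Fintype.sum_equiv (Equiv.mulLeft l⁻¹) _ _ fun h => ?_
    simp
  mul_compr₂_comul := by
    classical
    refine (basis k Γ H).ext fun p => (basis k Γ H).ext fun q => ?_
    change comulMap k Γ H (_ * _) = comulMap k Γ H _ * comulMap k Γ H _
    rw [basis_mul_basis, comulMap_basis, comulMap_basis, Finset.sum_mul_sum]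
    simp only [Algebra.TensorProduct.tmul_mul_tmul, basis_mul_basis]
    have : ∀ i : H, ∑ j : H, (if i = j then basis k Γ H (p.1 * q.1, i) else 0) ⊗ₜ[k]
        (if i⁻¹ * p.2 = j⁻¹ * q.2 then
          basis k Γ H ((i⁻¹ • p.1) * (j⁻¹ • q.1), i⁻¹ * p.2) else 0) =
        basis k Γ H (p.1 * q.1, i) ⊗ₜ[k] (if p.2 = q.2 then
          basis k Γ H (i⁻¹ • (p.1 * q.1), i⁻¹ * p.2) else 0) := by
      intro i
      rw [Finset.sum_eq_single i]
      · simp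
      · intro b _ hb
        rw [if_neg (Ne.symm hb), TensorProduct.zero_tmul]
      · simp
    simp only [this]
    split_ifs
    · rw [comulMap_basis]
    · simp

/-- The smash coproduct Hopf algebra `k[Γ] ⋊ k^H`. -/
instance : HopfAlgebra k (SmashCoproduct k Γ H) where
  antipode := antipodeMap k Γ H
  mul_antipode_rTensor_comul := by
    classical
    refine (basis k Γ H).ext fun p => ?_
    change LinearMap.mul' k _ ((antipodeMap k Γ H).rTensor _ (comulMap k Γ H _)) =
      algebraMap k _ (counitMap k Γ H _)
    simp only [comulMap_basis, map_sum, LinearMap.rTensor_tmul, antipodeMap_basis,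
      LinearMap.mul'_apply, basis_mul_basis, counitMap_basis]
    by_cases h : p.2 = 1
    · simp only [h, if_true, map_one, mul_one, one_eq_sum]
      refine Fintype.sum_equiv (Equiv.inv H) _ _ fun l => ?_
      simp
    · have h' : ∀ l : H, ¬ (l⁻¹ = l⁻¹ * p.2) := fun l hl => h (by simpa using hl)
      simp [h]
  mul_antipode_lTensor_comul := by
    classical
    refine (basis k Γ H).ext fun p => ?_
    change LinearMap.mul' k _ ((antipodeMap k Γ H).lTensor _ (comulMap k Γ H _)) =
      algebraMap k _ (counitMap k Γ H _)
    simp only [comulMap_basis, map_sum, LinearMap.lTensor_tmul, antipodeMap_basis,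
      LinearMap.mul'_apply, basis_mul_basis, counitMap_basis]
    by_cases h : p.2 = 1
    · simp only [h, if_true, map_one, mul_one, one_eq_sum]
      refine Finset.sum_congr rfl fun l _ => ?_
      simp
    · have h' : ∀ l : H, ¬ (l = (l⁻¹ * p.2)⁻¹) := fun l hl => h (by simpa using hl)
      simp only [if_neg (h' _), h]
      simp

end SmashCoproduct

/-! ### Quotient data -/

/-- A quotient datum `(G, N, Φ)` for an action of `H` by automorphisms on `Γ`: a subgroup `G` of
`H`, a normal and `G`-stable subgroup `N` of `Γ`, and a group morphism `Φ : N → (k^G)ˣ` with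
`Φ(r)(lh) = Φ(l⁻¹.r)(h) Φ(r)(l)` and `Φ(r) = Φ(srs⁻¹)`. -/
structure QuotientDatum (k Γ H : Type*) [Field k] [Group Γ] [Group H]
    [MulDistribMulAction H Γ] where
  G : Subgroup H
  N : Subgroup Γ
  normal : N.Normal
  stable : ∀ (l : G) (r : Γ), r ∈ N → l • r ∈ N
  Φ : N →* (G → k)ˣ
  map_mul' : ∀ (r : N) (l h : G), (Φ r : G → k) (l * h) =
    (Φ ⟨l⁻¹ • (r : Γ), stable l⁻¹ r r.2⟩ : G → k) h * (Φ r : G → k) l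
  map_conj' : ∀ (r : N) (s : Γ), Φ r = Φ ⟨s * r * s⁻¹, normal.conj_mem r r.2 s⟩

namespace QuotientDatum

variable {k Γ H : Type*} [Field k] [Group Γ] [Group H] [MulDistribMulAction H Γ]
  (D : QuotientDatum k Γ H)

instance : D.N.Normal := D.normal

/-- The action of `l ∈ G` on `Γ/N` induced by the action on `Γ`: `l.u(r) = u(l.r)`. -/
def act (l : D.G) : Γ ⧸ D.N →* Γ ⧸ D.N :=
  QuotientGroup.map D.N D.N (MulDistribMulAction.toMonoidHom Γ l) fun r hr => D.stable l r hr

theorem act_mk (l : D.G) (r : Γ) : D.act l (r : Γ ⧸ D.N) = ((l • r : Γ) : Γ ⧸ D.N) := rfl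

theorem act_one (x : Γ ⧸ D.N) : D.act 1 x = x := by
  induction x using QuotientGroup.induction_on with
  | H r => rw [act_mk, one_smul]

theorem act_mul (l m : D.G) (x : Γ ⧸ D.N) : D.act (l * m) x = D.act l (D.act m x) := by
  induction x using QuotientGroup.induction_on with
  | H r => rw [act_mk, act_mk, act_mk, mul_smul]

theorem map_smul_mul (n : D.G) (r : D.N) (h : D.G) :
    (D.Φ ⟨n • (r : Γ), D.stable n r r.2⟩ : D.G → k) (n * h) =
      (D.Φ r : D.G → k) h * (D.Φ ⟨n • (r : Γ), D.stable n r r.2⟩ : D.G → k) n := by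
  have := D.map_mul' ⟨n • (r : Γ), D.stable n r r.2⟩ n h
  simpa only [inv_smul_smul] using this

theorem map_apply_ne_zero (r : D.N) (h : D.G) : (D.Φ r : D.G → k) h ≠ 0 := by
  have : (D.Φ r : D.G → k) h * ((D.Φ r)⁻¹ : (D.G → k)ˣ).val h = 1 := by
    rw [← Pi.mul_apply, Units.mul_inv]; rfl
  exact left_ne_zero_of_mul (this ▸ one_ne_zero)

theorem map_apply_one (r : D.N) : (D.Φ r : D.G → k) 1 = 1 := by
  have h := D.map_mul' r 1 1
  simp only [inv_one, one_smul, mul_one] at h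
  have h0 := D.map_apply_ne_zero r 1
  exact (mul_left_cancel₀ h0 ((mul_one _).trans h)).symm

theorem map_smul_self (n : D.G) (r : D.N) :
    (D.Φ ⟨n • (r : Γ), D.stable n r r.2⟩ : D.G → k) n * (D.Φ r : D.G → k) n⁻¹ = 1 := by
  have := D.map_smul_mul n r n⁻¹
  rw [mul_inv_cancel, map_apply_one] at this
  rw [mul_comm]; exact this.symm

theorem map_eq_smul (n : D.G) (r : D.N) (h : D.G) :
    (D.Φ r : D.G → k) h = (D.Φ ⟨n • (r : Γ), D.stable n r r.2⟩ : D.G → k) (n * h) *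
      (D.Φ r : D.G → k) n⁻¹ := by
  rw [map_smul_mul, mul_assoc, map_smul_self, mul_one]

theorem map_mul_apply (r s : D.N) (h : D.G) :
    (D.Φ r : D.G → k) h * (D.Φ s : D.G → k) h = (D.Φ (r * s) : D.G → k) h := by
  rw [map_mul]; rfl

/-- A section `j : Γ/N → Γ` of the canonical projection `u`, normalized by `j(u(1)) = 1`. -/
structure NormalizedSection where
  toFun : Γ ⧸ D.N → Γ
  mk_toFun : ∀ x, (toFun x : Γ ⧸ D.N) = x
  toFun_one : toFun 1 = 1

variable {D} (j : D.NormalizedSection)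

namespace NormalizedSection

theorem mul_mem (x y : Γ ⧸ D.N) : j.toFun x * j.toFun y * (j.toFun (x * y))⁻¹ ∈ D.N := by
  rw [← QuotientGroup.eq_one_iff]
  simp [j.mk_toFun]

theorem smul_mem (l : D.G) (x : Γ ⧸ D.N) : (l • j.toFun x) * (j.toFun (D.act l x))⁻¹ ∈ D.N := by
  rw [← QuotientGroup.eq_one_iff]
  simp [← act_mk, j.mk_toFun]

theorem inv_mem (l : D.G) (x : Γ ⧸ D.N) :
    (j.toFun (D.act l x⁻¹))⁻¹ * (l • (j.toFun x)⁻¹) ∈ D.N := by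
  rw [← QuotientGroup.eq_one_iff]
  simp [← act_mk, j.mk_toFun]

/-- `Φ(j(x) j(y) j(xy)⁻¹) ∈ k^G`, for `x, y ∈ Γ/N`. -/
def mulFactor (x y : Γ ⧸ D.N) : D.G → k :=
  D.Φ ⟨j.toFun x * j.toFun y * (j.toFun (x * y))⁻¹, j.mul_mem x y⟩

/-- `Φ(l.j(x) j(l.x)⁻¹) ∈ k^G`, for `l ∈ G` and `x ∈ Γ/N`. -/
def comulFactor (l : D.G) (x : Γ ⧸ D.N) : D.G → k :=
  D.Φ ⟨(l • j.toFun x) * (j.toFun (D.act l x))⁻¹, j.smul_mem l x⟩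

/-- `Φ(j(l.x⁻¹)⁻¹ l.j(x)⁻¹) ∈ k^G`, for `l ∈ G` and `x ∈ Γ/N`. -/
def antipodeFactor (l : D.G) (x : Γ ⧸ D.N) : D.G → k :=
  D.Φ ⟨(j.toFun (D.act l x⁻¹))⁻¹ * (l • (j.toFun x)⁻¹), j.inv_mem l x⟩

theorem Φ_congr {a b : D.N} (h : (a : Γ) = b) (g : D.G) :
    (D.Φ a : D.G → k) g = (D.Φ b : D.G → k) g := by
  rw [Subtype.ext h]

theorem Φ_eq_one {a : D.N} (h : (a : Γ) = 1) (g : D.G) : (D.Φ a : D.G → k) g = 1 := by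
  have : a = 1 := Subtype.ext h
  rw [this, map_one]; rfl

theorem Φ_conj_apply (r : D.N) (s : Γ) (g : D.G) : (D.Φ r : D.G → k) g =
    (D.Φ ⟨s * r * s⁻¹, D.normal.conj_mem r r.2 s⟩ : D.G → k) g := by
  rw [← D.map_conj']

theorem mulFactor_assoc (x y z : Γ ⧸ D.N) (g : D.G) :
    j.mulFactor x y g * j.mulFactor (x * y) z g = j.mulFactor y z g * j.mulFactor x (y * z) g := by
  unfold mulFactor
  rw [map_mul_apply, Φ_conj_apply ⟨j.toFun y * _ * _, _⟩ (j.toFun x), map_mul_apply]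
  refine Φ_congr ?_ g
  simp only [Subgroup.coe_mul, mul_assoc x y z]
  group

theorem mulFactor_one_left (x : Γ ⧸ D.N) (g : D.G) : j.mulFactor 1 x g = 1 :=
  Φ_eq_one (by simp [j.toFun_one]) g

theorem mulFactor_one_right (x : Γ ⧸ D.N) (g : D.G) : j.mulFactor x 1 g = 1 :=
  Φ_eq_one (by simp [j.toFun_one]) g

theorem mulFactor_apply_one (x y : Γ ⧸ D.N) : j.mulFactor x y 1 = 1 := D.map_apply_one _

theorem comulFactor_apply_one (l : D.G) (x : Γ ⧸ D.N) : j.comulFactor l x 1 = 1 :=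
  D.map_apply_one _

theorem comulFactor_one_left (x : Γ ⧸ D.N) (g : D.G) : j.comulFactor 1 x g = 1 :=
  Φ_eq_one (by simp [act_one]) g

theorem comulFactor_one_right (l : D.G) (g : D.G) : j.comulFactor l 1 g = 1 :=
  Φ_eq_one (by simp [j.toFun_one]) g

theorem comulFactor_coassoc (n m h : D.G) (x : Γ ⧸ D.N) :
    j.comulFactor (n * m) x (n * m * h) * j.comulFactor m x n⁻¹ =
      j.comulFactor m x (m * h) * j.comulFactor n (D.act m x) (n * m * h) := by
  unfold comulFactor
  rw [D.map_eq_smul n ⟨(m • j.toFun x) * _, _⟩ (m * h), mul_right_comm, ← mul_assoc n m h,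
    map_mul_apply]
  congr 1
  refine Φ_congr ?_ _
  simp [act_mul, mul_smul]

theorem comulFactor_mul (l h : D.G) (x y : Γ ⧸ D.N) :
    j.mulFactor x y h * j.comulFactor l (x * y) (l * h) =
      j.comulFactor l x (l * h) * j.comulFactor l y (l * h) * j.mulFactor x y l⁻¹ *
        j.mulFactor (D.act l x) (D.act l y) (l * h) := by
  have e : ∀ a b c d : k, a * b * c * d = b * (a * d) * c := by intros; ring
  rw [e]
  unfold comulFactor mulFactor
  rw [D.map_eq_smul l _ h, mul_right_comm]
  rw [map_mul_apply, map_mul_apply, Φ_conj_apply ⟨(l • j.toFun y) * _, _⟩ (l • j.toFun x),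
    map_mul_apply]
  congr 1
  refine Φ_congr ?_ _
  simp [smul_mul', mul_assoc]

theorem antipode_left (l : D.G) (x : Γ ⧸ D.N) :
    j.antipodeFactor l x l * j.comulFactor l x l *
      j.mulFactor (D.act l x⁻¹) (D.act l x) l = 1 := by
  unfold antipodeFactor comulFactor mulFactor
  rw [map_mul_apply, Φ_conj_apply _ (j.toFun (D.act l x⁻¹)), map_mul_apply]
  refine Φ_eq_one ?_ _
  simp only [Subgroup.coe_mul, ← map_mul, inv_mul_cancel, map_one, j.toFun_one, smul_inv']
  group

theorem antipode_right (l : D.G) (x : Γ ⧸ D.N) :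
    j.comulFactor l x l * j.antipodeFactor l⁻¹ (D.act l x) l⁻¹ * j.mulFactor x x⁻¹ l⁻¹ = 1 := by
  have hx : D.act l⁻¹ (D.act l x)⁻¹ = x⁻¹ := by
    rw [← map_inv, ← act_mul, inv_mul_cancel, act_one]
  have hn : j.toFun x * (l⁻¹ • (j.toFun (D.act l x))⁻¹) ∈ D.N := by
    rw [← QuotientGroup.eq_one_iff]
    simp [← act_mk, j.mk_toFun, ← act_mul, act_one]
  have h1 : j.comulFactor l x l = (D.Φ ⟨l • (j.toFun x * (l⁻¹ • (j.toFun (D.act l x))⁻¹)),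
      D.stable l _ hn⟩ : D.G → k) l := by
    refine Φ_congr ?_ _
    simp
  have h2 : j.antipodeFactor l⁻¹ (D.act l x) l⁻¹ * j.mulFactor x x⁻¹ l⁻¹ =
      (D.Φ ⟨_, hn⟩ : D.G → k) l⁻¹ := by
    unfold antipodeFactor mulFactor
    rw [mul_comm, map_mul_apply]
    refine Φ_congr ?_ _
    simp [hx, j.toFun_one, mul_assoc]
  rw [mul_assoc, h2, h1]
  exact D.map_smul_self l ⟨_, hn⟩

end NormalizedSection

/-! ### The Hopf algebra of a quotient datum -/

/-- The vector space `k[Γ/N] ⊗ k^G`. -/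
abbrev TensorSpace (D : QuotientDatum k Γ H) : Type _ :=
  MonoidAlgebra k (Γ ⧸ D.N) ⊗[k] (D.G → k)

/-- The basis of `k[Γ/N] ⊗ k^G` given by the elements `x # δ_h = x ⊗ δ_h`, for `x ∈ Γ/N` and
`h ∈ G`. -/
def tensorBasis (D : QuotientDatum k Γ H) [Finite H] :
    Module.Basis ((Γ ⧸ D.N) × D.G) k D.TensorSpace :=
  (MonoidAlgebra.basis (Γ ⧸ D.N) k).tensorProduct (Pi.basisFun k D.G)

section mul

variable [Finite H]

open Classical in
/-- The multiplication of `k[Γ/N] ⋊_Φ k^G`, with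
`(x # δ_h)(y # δ_g) = xy # δ_h δ_g Φ(j(x) j(y) j(xy)⁻¹)`; here `δ_h δ_g` is `δ_h` if `h = g`
and `0` otherwise, and `δ_h f = f(h) δ_h`. -/
def mulMap : D.TensorSpace →ₗ[k] D.TensorSpace →ₗ[k] D.TensorSpace :=
  D.tensorBasis.constr k fun p => D.tensorBasis.constr k fun q =>
    if p.2 = q.2 then j.mulFactor p.1 q.1 p.2 • D.tensorBasis (p.1 * q.1, p.2) else 0

/-- The unit `1 # 1` of `k[Γ/N] ⋊_Φ k^G`, where `1 = ∑ h, δ_h` in `k^G`. -/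
def unit (D : QuotientDatum k Γ H) : D.TensorSpace := ∑ h : D.G, D.tensorBasis (1, h)

open Classical in
theorem mulMap_basis (p q : (Γ ⧸ D.N) × D.G) :
    mulMap j (D.tensorBasis p) (D.tensorBasis q) =
      if p.2 = q.2 then j.mulFactor p.1 q.1 p.2 • D.tensorBasis (p.1 * q.1, p.2) else 0 := by
  rw [mulMap, Module.Basis.constr_basis, Module.Basis.constr_basis]

theorem mulMap_one_left (a : D.TensorSpace) : mulMap j D.unit a = a := by
  suffices mulMap j D.unit = LinearMap.id from LinearMap.congr_fun this a
  refine D.tensorBasis.ext fun p => ?_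
  rw [LinearMap.id_apply, unit, map_sum, LinearMap.sum_apply]
  simp only [mulMap_basis]
  rw [Finset.sum_eq_single p.2] <;> simp +contextual [j.mulFactor_one_left]

theorem mulMap_one_right (a : D.TensorSpace) : mulMap j a D.unit = a := by
  suffices (mulMap j).flip D.unit = LinearMap.id from LinearMap.congr_fun this a
  refine D.tensorBasis.ext fun p => ?_
  rw [LinearMap.id_apply, LinearMap.flip_apply, unit, map_sum]
  simp only [mulMap_basis]
  rw [Finset.sum_eq_single p.2]
  · simp [j.mulFactor_one_right]
  · intro b _ hb
    rw [if_neg (Ne.symm hb)]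
  · simp

theorem mulMap_assoc (a b c : D.TensorSpace) :
    mulMap j (mulMap j a b) c = mulMap j a (mulMap j b c) := by
  suffices (mulMap j).compr₂ (mulMap j) = ((LinearMap.llcomp k D.TensorSpace D.TensorSpace
      D.TensorSpace).comp (mulMap j)).compl₂ (mulMap j) from
    LinearMap.congr_fun (LinearMap.congr_fun (LinearMap.congr_fun this a) b) c
  refine D.tensorBasis.ext fun p => D.tensorBasis.ext fun q => D.tensorBasis.ext fun r => ?_
  change mulMap j (mulMap j (D.tensorBasis p) (D.tensorBasis q)) (D.tensorBasis r) =
    mulMap j (D.tensorBasis p) (mulMap j (D.tensorBasis q) (D.tensorBasis r))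
  rw [mulMap_basis, mulMap_basis]
  by_cases h1 : p.2 = q.2 <;> by_cases h2 : q.2 = r.2
  · rw [if_pos h1, if_pos h2, map_smul, map_smul, LinearMap.smul_apply, mulMap_basis,
      mulMap_basis]
    simp only [h1, h2, if_true, smul_smul, mul_assoc]
    congr 1
    exact j.mulFactor_assoc _ _ _ _
  · rw [if_pos h1, if_neg h2, map_smul, map_zero, LinearMap.smul_apply, mulMap_basis]
    dsimp only
    rw [if_neg (h1 ▸ h2), smul_zero]
  · rw [if_neg h1, if_pos h2, map_smul, map_zero, LinearMap.zero_apply, mulMap_basis]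
    dsimp only
    rw [if_neg h1, smul_zero]
  · rw [if_neg h1, if_neg h2, map_zero, map_zero, LinearMap.zero_apply]

end mul

/-- The underlying space `k[Γ/N] ⊗ k^G` of the Hopf algebra `k[Γ/N] ⋊_Φ k^G` constructed
with the section `j`. It is a type synonym, because its Hopf algebra structure depends on `j`
and is not the tensor product one. -/
def TwistedSmash (_j : D.NormalizedSection) : Type _ := D.TensorSpace

namespace TwistedSmash

variable [Finite H]

instance : Ring (TwistedSmash j) where
  __ := (inferInstanceAs (AddCommGroup D.TensorSpace) : AddCommGroup (TwistedSmash j))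
  mul a b := mulMap j a b
  one := D.unit
  left_distrib a b c := map_add (mulMap j a) b c
  right_distrib a b c := LinearMap.map_add₂ (mulMap j) a b c
  zero_mul a := LinearMap.map_zero₂ (mulMap j) a
  mul_zero a := map_zero (mulMap j a)
  mul_assoc a b c := mulMap_assoc j a b c
  one_mul a := mulMap_one_left j a
  mul_one a := mulMap_one_right j a

instance : Algebra k (TwistedSmash j) :=
  letI : Module k (TwistedSmash j) := inferInstanceAs (Module k D.TensorSpace)
  Algebra.ofModule
    (fun r a b => LinearMap.map_smul₂ (mulMap j) r a b)
    (fun r a b => map_smul (mulMap j a) r b)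

/-- The basis of the elements `x # δ_h = x ⊗ δ_h`, for `x ∈ Γ/N` and `h ∈ G`. -/
def basis : Module.Basis ((Γ ⧸ D.N) × D.G) k (TwistedSmash j) := D.tensorBasis

open Classical in
theorem basis_mul_basis (p q : (Γ ⧸ D.N) × D.G) : basis j p * basis j q =
    if p.2 = q.2 then j.mulFactor p.1 q.1 p.2 • basis j (p.1 * q.1, p.2) else 0 :=
  mulMap_basis j p q

theorem one_def : (1 : TwistedSmash j) = ∑ h : D.G, basis j (1, h) := rfl

/-- The comultiplication, with
`Δ(x # δ_h) = ∑ l, (x # δ_{l⁻¹}) ⊗ (l.x # δ_{lh} Φ(l.j(x) j(l.x)⁻¹))`. -/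
def comulMap : TwistedSmash j →ₗ[k] TwistedSmash j ⊗[k] TwistedSmash j :=
  (basis j).constr k fun p => ∑ l : D.G,
    basis j (p.1, l⁻¹) ⊗ₜ[k] (j.comulFactor l p.1 (l * p.2) • basis j (D.act l p.1, l * p.2))

open Classical in
/-- The counit, with `ε(x # δ_h) = δ_{h,1}`. -/
def counitMap : TwistedSmash j →ₗ[k] k :=
  (basis j).constr k fun p => if p.2 = 1 then 1 else 0

/-- The antipode, with
`S(x # δ_h) = h⁻¹.x⁻¹ # Φ(j(h⁻¹.x⁻¹)⁻¹ h⁻¹.j(x)⁻¹) δ_{h⁻¹}`. -/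
def antipodeMap : TwistedSmash j →ₗ[k] TwistedSmash j :=
  (basis j).constr k fun p =>
    j.antipodeFactor p.2⁻¹ p.1 p.2⁻¹ • basis j (D.act p.2⁻¹ p.1⁻¹, p.2⁻¹)

theorem comulMap_basis (p : (Γ ⧸ D.N) × D.G) : comulMap j (basis j p) = ∑ l : D.G,
    basis j (p.1, l⁻¹) ⊗ₜ[k] (j.comulFactor l p.1 (l * p.2) • basis j (D.act l p.1, l * p.2)) :=
  Module.Basis.constr_basis _ _ _ _

open Classical in
theorem counitMap_basis (p : (Γ ⧸ D.N) × D.G) :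
    counitMap j (basis j p) = if p.2 = 1 then 1 else 0 :=
  Module.Basis.constr_basis _ _ _ _

theorem antipodeMap_basis (p : (Γ ⧸ D.N) × D.G) : antipodeMap j (basis j p) =
    j.antipodeFactor p.2⁻¹ p.1 p.2⁻¹ • basis j (D.act p.2⁻¹ p.1⁻¹, p.2⁻¹) :=
  Module.Basis.constr_basis _ _ _ _

instance : Coalgebra k (TwistedSmash j) where
  comul := comulMap j
  counit := counitMap j
  coassoc := by
    refine (basis j).ext fun p => ?_
    simp only [LinearMap.comp_apply, comulMap_basis, map_sum, LinearMap.rTensor_tmul,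
      LinearMap.lTensor_tmul, TensorProduct.sum_tmul, TensorProduct.tmul_sum,
      LinearEquiv.coe_coe, TensorProduct.assoc_tmul, map_smul, TensorProduct.tmul_smul,
      TensorProduct.smul_tmul', smul_smul, Finset.smul_sum]
    rw [Finset.sum_comm]
    refine Finset.sum_congr rfl fun m _ => ?_
    refine (Fintype.sum_equiv (Equiv.mulRight m) _ _ fun n => ?_).symm
    have hm : m * (n * m)⁻¹ = n⁻¹ := by group
    have hc := j.comulFactor_coassoc n m p.2 p.1
    simp only [Equiv.coe_mulRight, hm, ← TensorProduct.smul_tmul', TensorProduct.tmul_smul,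
      smul_smul, act_mul]
    rw [← mul_assoc n m p.2, hc, mul_comm]
  rTensor_counit_comp_comul := by
    refine (basis j).ext fun p => ?_
    simp only [LinearMap.comp_apply, comulMap_basis, map_sum, LinearMap.rTensor_tmul,
      counitMap_basis, TensorProduct.mk_apply]
    rw [Finset.sum_eq_single 1] <;> simp +contextual [j.comulFactor_one_left, act_one]
  lTensor_counit_comp_comul := by
    refine (basis j).ext fun p => ?_
    simp only [LinearMap.comp_apply, comulMap_basis, map_sum, LinearMap.lTensor_tmul,
      counitMap_basis, TensorProduct.mk_apply, LinearMap.flip_apply, map_smul]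
    rw [Finset.sum_eq_single p.2⁻¹]
    · simp [j.comulFactor_apply_one]
    · intro b _ hb
      rw [if_neg, smul_zero, TensorProduct.tmul_zero]
      rw [mul_eq_one_iff_eq_inv]
      exact hb
    · simp

theorem comul_eq : (Coalgebra.comul : TwistedSmash j →ₗ[k] _) = comulMap j := rfl

theorem counit_eq : (Coalgebra.counit : TwistedSmash j →ₗ[k] k) = counitMap j := rfl

theorem comulMap_mul (p q : (Γ ⧸ D.N) × D.G) :
    comulMap j (basis j p * basis j q) = comulMap j (basis j p) * comulMap j (basis j q) := by
  rw [basis_mul_basis, comulMap_basis, comulMap_basis, Finset.sum_mul_sum]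
  have key : ∀ l : D.G, ∑ m : D.G,
      (basis j (p.1, l⁻¹) ⊗ₜ[k]
        (j.comulFactor l p.1 (l * p.2) • basis j (D.act l p.1, l * p.2))) *
      (basis j (q.1, m⁻¹) ⊗ₜ[k]
        (j.comulFactor m q.1 (m * q.2) • basis j (D.act m q.1, m * q.2))) =
      (basis j (p.1, l⁻¹) ⊗ₜ[k]
        (j.comulFactor l p.1 (l * p.2) • basis j (D.act l p.1, l * p.2))) *
      (basis j (q.1, l⁻¹) ⊗ₜ[k]
        (j.comulFactor l q.1 (l * q.2) • basis j (D.act l q.1, l * q.2))) := by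
    intro l
    refine Finset.sum_eq_single l (fun b _ hb => ?_) (fun h => absurd (Finset.mem_univ l) h)
    rw [Algebra.TensorProduct.tmul_mul_tmul, basis_mul_basis,
      if_neg (fun h => hb (inv_injective h).symm), TensorProduct.zero_tmul]
  rw [Finset.sum_congr rfl fun l _ => key l]
  by_cases h : p.2 = q.2
  · rw [if_pos h, map_smul, comulMap_basis, Finset.smul_sum]
    refine Finset.sum_congr rfl fun l _ => ?_
    rw [Algebra.TensorProduct.tmul_mul_tmul, basis_mul_basis, smul_mul_smul_comm,
      basis_mul_basis, ← h, if_pos rfl, if_pos rfl, smul_smul, TensorProduct.tmul_smul,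
      TensorProduct.tmul_smul, ← TensorProduct.smul_tmul', smul_smul, smul_smul,
      j.comulFactor_mul l p.2 p.1 q.1, map_mul]
    congr 1
    ring
  · rw [if_neg h, map_zero]
    refine (Finset.sum_eq_zero fun l _ => ?_).symm
    rw [Algebra.TensorProduct.tmul_mul_tmul, smul_mul_smul_comm, basis_mul_basis j (_, l * _),
      if_neg (fun h' => h (mul_left_cancel h')), smul_zero, TensorProduct.tmul_zero]

instance : Bialgebra k (TwistedSmash j) where
  counit_one := by
    change counitMap j 1 = 1
    simp [one_def, counitMap_basis]
  mul_compr₂_counit := by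
    refine (basis j).ext fun p => (basis j).ext fun q => ?_
    change counitMap j (_ * _) = counitMap j _ * counitMap j _
    rw [basis_mul_basis, counitMap_basis, counitMap_basis]
    by_cases h : p.2 = q.2
    · rw [if_pos h, map_smul, counitMap_basis, ← h]
      by_cases h1 : p.2 = 1
      · simp [h1, j.mulFactor_apply_one]
      · simp [h1]
    · rw [if_neg h, map_zero]
      by_cases h1 : p.2 = 1
      · have h2 : q.2 ≠ 1 := fun h2 => h (h1.trans h2.symm)
        simp [h2]
      · simp [h1]
  comul_one := by
    change comulMap j 1 = 1
    rw [Algebra.TensorProduct.one_def, one_def, map_sum, TensorProduct.sum_tmul]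
    simp only [comulMap_basis, TensorProduct.tmul_sum]
    rw [Finset.sum_comm]
    refine Fintype.sum_equiv (Equiv.inv _) _ _ fun l => ?_
    refine Fintype.sum_equiv (Equiv.mulLeft l) _ _ fun h => ?_
    simp [j.comulFactor_one_right]
  mul_compr₂_comul := by
    refine (basis j).ext fun p => (basis j).ext fun q => ?_
    rw [LinearMap.compr₂_apply, LinearMap.compl₁₂_apply, LinearMap.mul_apply',
      LinearMap.mul_apply', comul_eq]
    exact comulMap_mul j p q

/-- The Hopf algebra `k[Γ/N] ⋊_Φ k^G`. -/
instance : HopfAlgebra k (TwistedSmash j) where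
  antipode := antipodeMap j
  mul_antipode_rTensor_comul := by
    refine (basis j).ext fun p => ?_
    change LinearMap.mul' k _ ((antipodeMap j).rTensor _ (comulMap j _)) =
      algebraMap k _ (counitMap j _)
    simp only [comulMap_basis, map_sum, LinearMap.rTensor_tmul, antipodeMap_basis,
      LinearMap.mul'_apply, basis_mul_basis, counitMap_basis, smul_mul_smul_comm, inv_inv]
    by_cases h : p.2 = 1
    · simp only [h, if_true, map_one, mul_one, one_def, smul_smul]
      refine Finset.sum_congr rfl fun l _ => ?_
      rw [j.antipode_left, one_smul, ← map_mul, inv_mul_cancel, map_one]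
    · simp [h]
  mul_antipode_lTensor_comul := by
    refine (basis j).ext fun p => ?_
    change LinearMap.mul' k _ ((antipodeMap j).lTensor _ (comulMap j _)) =
      algebraMap k _ (counitMap j _)
    simp only [comulMap_basis, map_sum, LinearMap.lTensor_tmul, antipodeMap_basis,
      LinearMap.mul'_apply, basis_mul_basis, counitMap_basis, map_smul, mul_smul_comm, smul_smul]
    by_cases h : p.2 = 1
    · simp only [h, if_true, map_one, mul_one, one_def, smul_smul]
      refine Fintype.sum_equiv (Equiv.inv _) _ _ fun l => ?_
      have hx : D.act l⁻¹ (D.act l p.1)⁻¹ = p.1⁻¹ := by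
        rw [← map_inv, ← act_mul, inv_mul_cancel, act_one]
      rw [hx, j.antipode_right, one_smul, mul_inv_cancel]
      rfl
    · have h' : ∀ l : D.G, ¬ (l⁻¹ = (l * p.2)⁻¹) := fun l hl => h (by simpa using hl)
      simp only [if_neg (h' _), h]
      simp

end TwistedSmash
end QuotientDatum
end

/-! Write e(r,h) = π(r # δ_h), which is `img π r h`. Then e(r,h) e(s,g) is e(rs,h) when g = h and 0
otherwise, and injectivity on k^H makes every e(r,h) nonzero. Multiplying Δ on the left by e(1,l) ⊗
1 isolates one term of the comultiplication: e(r,h) ↦ e(r,l) ⊗ e(l⁻¹.r, l⁻¹h) (`leftPart_img`). The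
argument rests on this formula.

Let N be the set of r for which every e(r,h) is a multiple of e(1,h), and let Φ(r)(h) be the scalar.
The product rule makes N a normal subgroup and Φ a conjugation-invariant morphism; `leftPart` at l
makes N stable under H and gives the identity for Φ(r)(lh) (`img_inv_smul`).

For l = 1 the formula reads e(r,1) ↦ e(r,1) ⊗ e(r,1), so distinct e(r,1) are linearly independent,
like group-like elements. If e(r,1) = e(1,1), the other components of the formula force r ∈ N
(`mem_scalarSubgroup_of_img_one`). Hence the e(j(x),h), for x ∈ Γ/N and h ∈ H, are linearly
independent (`linearIndependent_img`). They span L because representatives of one class differ by an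
element of N, so x # δ_h ↦ e(j(x),h) is bijective. The factors Φ(...) in the product and coproduct
are what it costs to return to the representatives chosen by j. -/

noncomputable section

attribute [local instance] Fintype.ofFinite

/-! ### Linear algebra: relations in tensor products and independence of group-like vectors. -/

section LinearAlgebra

variable {k V W ι : Type*} [Field k] [AddCommGroup V] [Module k V] [AddCommGroup W] [Module k W]

/-- If the vectors `a i` are linearly independent, then `∑ a i ⊗ w i = 0` forces `w i = 0`. -/
theorem eq_zero_of_sum_tmul_eq_zero {s : Finset ι} {a : ι → V} {w : ι → W}
    (ha : LinearIndepOn k a (s : Set ι)) (h : ∑ i ∈ s, a i ⊗ₜ[k] w i = 0) :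
    ∀ i ∈ s, w i = 0 := by
  intro i hi
  by_contra hw
  -- Contracting the second factor with a functional φ such that φ(w i) = 1 leaves a relation among
  -- the `a` whose coefficient at `i` is 1.
  obtain ⟨φ, hφ⟩ := Module.Projective.exists_dual_eq_one k hw
  have h1 := congrArg (TensorProduct.rid k V ∘ φ.lTensor V) h
  simp only [Function.comp_apply, map_sum, LinearMap.lTensor_tmul, TensorProduct.rid_tmul,
    map_zero] at h1
  have h2 := linearIndepOn_finset_iff.1 ha (fun i => φ (w i)) h1 i hi
  exact one_ne_zero (hφ.symm.trans h2)

/-- Distinct nonzero vectors which are group-like for a linear map `T : V → V ⊗ V` are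
linearly independent. -/
theorem linearIndependent_of_map_eq_tmul_self (T : V →ₗ[k] V ⊗[k] V) {v : ι → V}
    (hv : Function.Injective v) (h0 : ∀ i, v i ≠ 0) (hT : ∀ i, T (v i) = v i ⊗ₜ v i) :
    LinearIndependent k v := by
  classical
  rw [← linearIndepOn_univ_iff, linearIndepOn_iff_linearIndepOn_finset]
  rintro s -
  induction s using Finset.induction_on with
  | empty => simp
  | insert a s has ih =>
    rw [linearIndepOn_finset_iff]
    intro c hc
    rw [Finset.sum_insert has] at hc
    -- Compare the image of the relation under `T` with the relation tensored by `v a`: the terms at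
    -- `a` coincide and cancel, leaving a relation indexed by `s` to which the induction hypothesis
    -- applies.
    have h1 := congrArg T hc
    have h2 := congrArg (· ⊗ₜ[k] v a) hc
    simp only [map_add, map_sum, map_smul, hT, map_zero, TensorProduct.add_tmul,
      TensorProduct.sum_tmul, TensorProduct.zero_tmul, ← TensorProduct.smul_tmul'] at h1 h2
    have h3 : ∑ i ∈ s, v i ⊗ₜ[k] (c i • (v i - v a)) = 0 := by
      simp only [TensorProduct.tmul_smul, TensorProduct.tmul_sub, smul_sub,
        Finset.sum_sub_distrib]
      rw [sub_eq_zero]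
      exact add_left_cancel (h1.trans h2.symm)
    have h4 : ∀ i ∈ s, c i = 0 := fun i hi => by
      refine (smul_eq_zero.1 (eq_zero_of_sum_tmul_eq_zero ih h3 i hi)).resolve_right ?_
      exact sub_ne_zero.2 fun h => has (hv h ▸ hi)
    rw [Finset.sum_eq_zero (fun i hi => by rw [h4 i hi, zero_smul]), add_zero] at hc
    intro i hi
    rcases Finset.mem_insert.1 hi with rfl | hi
    · exact (smul_eq_zero.1 hc).resolve_right (h0 i)
    · exact h4 i hi

end LinearAlgebra

/-! ### The images of the basis elements in L. -/

namespace SmashCoproduct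

variable {k Γ H L : Type*} [Field k] [Group Γ] [Group H] [Finite H]
    [MulDistribMulAction H Γ] [Ring L] [HopfAlgebra k L]
    (π : SmashCoproduct k Γ H →ₐc[k] L)

/-- The image of `r # δ_h`. -/
def img (r : Γ) (h : H) : L := π (basis k Γ H (r, h))

theorem map_tmul (r : Γ) (f : H → k) : π (tmul r f) = ∑ h, f h • img π r h := by
  rw [tmul_eq_sum, map_sum]
  exact Finset.sum_congr rfl fun h _ => map_smul π _ _

open Classical in
theorem img_mul_img (r s : Γ) (h g : H) :
    img π r h * img π s g = if h = g then img π (r * s) h else 0 := by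
  unfold img
  rw [← map_mul, basis_mul_basis]
  split_ifs <;> simp

theorem img_mul_img_self (r s : Γ) (h : H) : img π r h * img π s h = img π (r * s) h := by
  rw [img_mul_img, if_pos rfl]

theorem sum_img_one : ∑ h, img π 1 h = 1 := by
  unfold img
  rw [← map_sum, ← one_eq_sum, map_one]

theorem comul_img (r : Γ) (h : H) : Coalgebra.comul (R := k) (img π r h) =
    ∑ l : H, img π r l ⊗ₜ[k] img π (l⁻¹ • r) (l⁻¹ * h) := by
  unfold img
  rw [← CoalgHomClass.map_comp_comul_apply]
  refine (congrArg _ (comulMap_basis (r, h))).trans ?_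
  rw [map_sum]
  rfl

open Classical in
theorem counit_img (r : Γ) (h : H) :
    Coalgebra.counit (R := k) (img π r h) = if h = 1 then 1 else 0 := by
  unfold img
  rw [CoalgHomClass.counit_comp_apply]
  exact counitMap_basis (r, h)

/-- The component `x ↦ (1 # δ_l ⊗ 1) Δ(x)` of the comultiplication. -/
def leftPart (l : H) : L →ₗ[k] L ⊗[k] L :=
  LinearMap.mulLeft k (img π 1 l ⊗ₜ[k] (1 : L)) ∘ₗ Coalgebra.comul

/-- The elements `img π 1 l` are orthogonal idempotents, so only the term at `l` of the
comultiplication survives. At `l = 1` the elements `img π r 1` become group-like for this map. -/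
theorem leftPart_img (l : H) (r : Γ) (h : H) :
    leftPart π l (img π r h) = img π r l ⊗ₜ[k] img π (l⁻¹ • r) (l⁻¹ * h) := by
  classical
  rw [leftPart, LinearMap.comp_apply, comul_img, LinearMap.mulLeft_apply, Finset.mul_sum,
    Finset.sum_eq_single l]
  · rw [Algebra.TensorProduct.tmul_mul_tmul, img_mul_img_self, one_mul, one_mul]
  · intro b _ hb
    rw [Algebra.TensorProduct.tmul_mul_tmul, img_mul_img, if_neg hb.symm, TensorProduct.zero_tmul]
  · simp

variable {π} (hinj : Function.Injective fun f : H → k => π (tmul (1 : Γ) f))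
include hinj

theorem linearIndependent_img_one : LinearIndependent k (img π 1) := by
  rw [Fintype.linearIndependent_iff]
  intro c hc
  have : c = 0 := by
    refine hinj ?_
    simp only [map_tmul, hc]
    simp
  simp [this]

/-- Multiplication by `img π r⁻¹ h` turns `img π r h` into `img π 1 h`, which is nonzero by
injectivity on k^H. -/
theorem img_ne_zero (r : Γ) (h : H) : img π r h ≠ 0 := by
  intro h0
  refine (linearIndependent_img_one hinj).ne_zero h ?_
  rw [← inv_mul_cancel r, ← img_mul_img_self, h0, mul_zero]

theorem smul_img_one_injective (h : H) : Function.Injective fun c : k => c • img π (1 : Γ) h :=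
  smul_left_injective k (img_ne_zero hinj 1 h)

/-! ### The subgroup N and the scalars Φ. -/

omit hinj

variable (π) in
/-- The subgroup of the elements `r` such that every `r # δ_h` is mapped to a multiple of
the image of `1 # δ_h`. -/
def scalarSubgroup : Subgroup Γ where
  carrier := {r | ∀ h, ∃ c : k, img π r h = c • img π 1 h}
  one_mem' _ := ⟨1, (one_smul _ _).symm⟩
  mul_mem' {r s} hr hs h := by
    obtain ⟨c, hc⟩ := hr h
    obtain ⟨d, hd⟩ := hs h
    exact ⟨c * d, by rw [← img_mul_img_self, hc, hd, smul_mul_smul_comm, img_mul_img_self,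
      one_mul]⟩
  inv_mem' {r} hr h := by
    obtain ⟨c, hc⟩ := hr h
    have h1 : img π 1 h = c • img π r⁻¹ h := by
      rw [← inv_mul_cancel r, ← img_mul_img_self, hc, mul_smul_comm, img_mul_img_self, mul_one]
    -- Injectivity on k^H is not assumed here, so `c` may vanish; then the whole component at `h` is
    -- zero and the scalar 0 serves.
    rcases eq_or_ne c 0 with rfl | hc0
    · refine ⟨0, ?_⟩
      rw [zero_smul] at h1 ⊢
      rw [← mul_one r⁻¹, ← img_mul_img_self, h1, mul_zero]
    · exact ⟨c⁻¹, by rw [h1, inv_smul_smul₀ hc0]⟩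

/-- The scalar `c` such that `r # δ_h` has the same image as `c • 1 # δ_h`. -/
def coef (r : scalarSubgroup π) (h : H) : k := (r.2 h).choose

theorem img_eq_coef_smul (r : scalarSubgroup π) (h : H) :
    img π (r : Γ) h = coef r h • img π 1 h := (r.2 h).choose_spec

theorem img_coe_mul (r : scalarSubgroup π) (s : Γ) (h : H) :
    img π (r * s) h = coef r h • img π s h := by
  rw [← img_mul_img_self, img_eq_coef_smul, smul_mul_assoc, img_mul_img_self, one_mul]

/-- Applied to two representatives of one class modulo N, this produces the factors Φ(...) in the
product and coproduct of the twisted Hopf algebra. -/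
theorem img_eq_smul_img {s t : Γ} (hst : s * t⁻¹ ∈ scalarSubgroup π) (h : H) :
    img π s h = coef ⟨_, hst⟩ h • img π t h := by
  rw [← img_coe_mul, inv_mul_cancel_right]

/-- The scalar passes through the product of the images of `s`, `r` and `s⁻¹`. Keeping `c` general
yields both the normality of N and the conjugation invariance of Φ. -/
theorem img_conj {r : Γ} {h : H} {c : k} (hc : img π r h = c • img π 1 h) (s : Γ) :
    img π (s * r * s⁻¹) h = c • img π 1 h := by
  rw [← img_mul_img_self, ← img_mul_img_self, hc, mul_smul_comm, smul_mul_assoc,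
    img_mul_img_self, mul_one, img_mul_img_self, mul_inv_cancel]

instance : (scalarSubgroup π).Normal where
  conj_mem r hr s h := ⟨coef ⟨r, hr⟩ h, img_conj (img_eq_coef_smul ⟨r, hr⟩ h) s⟩

include hinj

/-- `coef` is an arbitrary choice, made unique by `img π 1 h ≠ 0`. Identities for Φ then follow by
exhibiting a scalar. -/
theorem coef_eq {r : scalarSubgroup π} {h : H} {c : k} (hc : img π (r : Γ) h = c • img π 1 h) :
    coef r h = c :=
  smul_img_one_injective hinj h ((img_eq_coef_smul r h).symm.trans hc)

theorem coef_ne_zero (r : scalarSubgroup π) (h : H) : coef r h ≠ 0 := by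
  intro h0
  apply img_ne_zero hinj (r : Γ) h
  rw [img_eq_coef_smul, h0, zero_smul]

theorem coef_mul (r s : scalarSubgroup π) (h : H) : coef (r * s) h = coef r h * coef s h :=
  coef_eq hinj (by rw [Subgroup.coe_mul, img_coe_mul, img_eq_coef_smul, smul_smul])

/-- Applying `leftPart π l` to the relation for `r` at `l * h` yields a relation for `l⁻¹ • r` at
`h`. This gives at once the stability of N under H and the formula for Φ(r)(lh). -/
theorem img_inv_smul (r : scalarSubgroup π) (l h : H) :
    img π (l⁻¹ • (r : Γ)) h = ((coef r l)⁻¹ * coef r (l * h)) • img π 1 h := by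
  have h1 : img π (1 : Γ) l ⊗ₜ[k] (coef r l • img π (l⁻¹ • (r : Γ)) h) =
      img π (1 : Γ) l ⊗ₜ[k] (coef r (l * h) • img π 1 h) := by
    have := congrArg (leftPart π l) (img_eq_coef_smul r (l * h))
    rw [map_smul, leftPart_img, leftPart_img, inv_mul_cancel_left, smul_one, img_eq_coef_smul,
      TensorProduct.smul_tmul, ← TensorProduct.tmul_smul] at this
    exact this
  obtain ⟨φ, hφ⟩ := Module.Projective.exists_dual_eq_one k (img_ne_zero hinj (1 : Γ) l)
  have h2 := congrArg (TensorProduct.lid k L ∘ φ.rTensor L) h1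
  simp only [Function.comp_apply, LinearMap.rTensor_tmul, TensorProduct.lid_tmul, hφ,
    one_smul] at h2
  rw [mul_smul, ← h2, inv_smul_smul₀ (coef_ne_zero hinj r l)]

theorem inv_smul_mem_scalarSubgroup (r : scalarSubgroup π) (l : H) :
    l⁻¹ • (r : Γ) ∈ scalarSubgroup π := fun h => ⟨_, img_inv_smul hinj r l h⟩

theorem smul_mem_scalarSubgroup (l : H) {r : Γ} (hr : r ∈ scalarSubgroup π) :
    l • r ∈ scalarSubgroup π := by
  simpa using inv_smul_mem_scalarSubgroup hinj ⟨r, hr⟩ l⁻¹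

theorem coef_mul_apply (r : scalarSubgroup π) (l h : H) :
    coef r (l * h) = coef ⟨l⁻¹ • (r : Γ), smul_mem_scalarSubgroup hinj l⁻¹ r.2⟩ h * coef r l := by
  have h1 := coef_eq hinj
    (r := ⟨l⁻¹ • (r : Γ), smul_mem_scalarSubgroup hinj l⁻¹ r.2⟩) (img_inv_smul hinj r l h)
  rw [h1, mul_comm, mul_inv_cancel_left₀ (coef_ne_zero hinj r l)]

theorem coef_conj (r : scalarSubgroup π) (s : Γ) (h : H) :
    coef ⟨s * r * s⁻¹, Subgroup.Normal.conj_mem inferInstance _ r.2 s⟩ h = coef r h :=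
  coef_eq hinj (img_conj (img_eq_coef_smul r h) s)

/-! ### Linear independence modulo N. -/

/-- Membership in the scalar subgroup is detected on the component of the identity of `H`. -/
theorem mem_scalarSubgroup_of_img_one {r : Γ} (hr : img π r 1 = img π 1 1) :
    r ∈ scalarSubgroup π := by
  intro h
  have h1 := congrArg (leftPart π h) hr
  rw [leftPart_img, leftPart_img, smul_one, mul_one] at h1
  -- The second factor on the left of `h1` is nonzero; contracting it exhibits `img π r h` as a
  -- multiple of `img π 1 h`.
  obtain ⟨φ, hφ⟩ := Module.Projective.exists_dual_eq_one k (img_ne_zero hinj (h⁻¹ • r) h⁻¹)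
  have h2 := congrArg (TensorProduct.rid k L ∘ φ.lTensor L) h1
  simp only [Function.comp_apply, LinearMap.lTensor_tmul, TensorProduct.rid_tmul, hφ,
    one_smul] at h2
  exact ⟨_, h2⟩

/-- Elements with pairwise distinct classes modulo the scalar subgroup give linearly independent
families in `L`. -/
theorem linearIndependent_img {X : Type*} {t : X → Γ}
    (ht : ∀ x y, t x * (t y)⁻¹ ∈ scalarSubgroup π → x = y) :
    LinearIndependent k fun p : X × H => img π (t p.1) p.2 := by
  classical
  have h1 : LinearIndependent k fun x => img π (t x) (1 : H) := by
    refine linearIndependent_of_map_eq_tmul_self (leftPart π 1) (fun x y hxy => ht x y ?_)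
      (fun x => img_ne_zero hinj _ _) fun x => ?_
    · refine mem_scalarSubgroup_of_img_one hinj ?_
      rw [← img_mul_img_self, hxy, img_mul_img_self, mul_inv_cancel]
    · rw [leftPart_img, inv_one, one_smul, one_mul]
  rw [linearIndependent_iff']
  intro s c hc
  -- Extension of `c` by zero, so that the relation runs over a full rectangle `s' × H` and can be
  -- grouped by `x`.
  let c' : X → H → k := fun x h => if (x, h) ∈ s then c (x, h) else 0
  let s' := s.image Prod.fst
  have hsum : ∑ x ∈ s', ∑ h, c' x h • img π (t x) h = 0 := by
    rw [← hc, ← Finset.sum_product']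
    refine (Finset.sum_subset (s₁ := s) (fun p hp => ?_) fun p _ hp => ?_).symm.trans ?_
    · exact Finset.mem_product.2 ⟨Finset.mem_image_of_mem _ hp, Finset.mem_univ _⟩
    · simp [c', hp]
    · exact Finset.sum_congr rfl fun p hp => by simp [c', hp]
  -- `leftPart π 1` puts the independent vectors `img π (t x) 1` in the first factor, separating the
  -- relation into one for each `x`.
  have h2 : ∑ x ∈ s', img π (t x) 1 ⊗ₜ[k] ∑ h, c' x h • img π (t x) h = 0 := by
    rw [← map_zero (leftPart π 1), ← hsum, map_sum]
    refine Finset.sum_congr rfl fun x _ => ?_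
    rw [map_sum, TensorProduct.tmul_sum]
    refine Finset.sum_congr rfl fun h _ => ?_
    rw [map_smul, leftPart_img, inv_one, one_smul, one_mul, TensorProduct.tmul_smul]
  have h3 := eq_zero_of_sum_tmul_eq_zero (h1.linearIndepOn _) h2
  rintro ⟨x, h⟩ hp
  -- Multiplication by the image of `(t x)⁻¹ # δ_h` kills the components other than `h` and turns
  -- the remaining one into a multiple of `img π 1 h`.
  have h4 := congrArg (img π (t x)⁻¹ h * ·) (h3 x (Finset.mem_image_of_mem _ hp))
  simp only [Finset.mul_sum, mul_smul_comm, mul_zero] at h4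
  rw [Finset.sum_eq_single h] at h4
  · rw [img_mul_img_self, inv_mul_cancel] at h4
    simpa [c', hp] using (smul_eq_zero.1 h4).resolve_right (img_ne_zero hinj 1 h)
  · intro g _ hg
    rw [img_mul_img, if_neg hg.symm, smul_zero]
  · simp

-- Multiplying by the idempotent `img π 1 h` isolates the component at `h`. This links the
-- componentwise definition of N to its description through π(r # 1) = π(1 # f).
omit hinj in
theorem map_tmul_one_eq_iff {r : Γ} {f : H → k} :
    π (tmul r 1) = π (tmul 1 f) ↔ ∀ h, img π r h = f h • img π 1 h := by
  classical
  rw [map_tmul, map_tmul]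
  simp only [Pi.one_apply, one_smul]
  refine ⟨fun he h => ?_, fun he => Finset.sum_congr rfl fun h _ => he h⟩
  have := congrArg (img π 1 h * ·) he
  simp only [Finset.mul_sum, mul_smul_comm, img_mul_img, one_mul] at this
  simpa using this

theorem mem_scalarSubgroup_iff_exists_unit {r : Γ} : r ∈ scalarSubgroup π ↔
    ∃ f : (H → k)ˣ, π (tmul r 1) = π (tmul 1 (f : H → k)) := by
  constructor
  · intro hr
    have hu : IsUnit (coef (⟨r, hr⟩ : scalarSubgroup π)) :=
      Pi.isUnit_iff.2 fun h => (coef_ne_zero hinj ⟨r, hr⟩ h).isUnit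
    exact ⟨hu.unit, map_tmul_one_eq_iff.2 fun h => img_eq_coef_smul ⟨r, hr⟩ h⟩
  · rintro ⟨f, hf⟩ h
    exact ⟨_, map_tmul_one_eq_iff.1 hf h⟩


end SmashCoproduct

/-! ### The quotient datum and the isomorphism onto L. -/

namespace SmashCoproduct

variable {k Γ H L : Type*} [Field k] [Group Γ] [Group H] [Finite H]
    [MulDistribMulAction H Γ] [Ring L] [HopfAlgebra k L]
    {π : SmashCoproduct k Γ H →ₐc[k] L}
    (hinj : Function.Injective fun f : H → k => π (tmul (1 : Γ) f))

/-- The quotient datum `(H, N, Φ)` of a Hopf algebra map which is injective on `k^H`. -/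
def scalarDatum : QuotientDatum k Γ H where
  G := ⊤
  N := scalarSubgroup π
  normal := inferInstance
  stable l _ hr := smul_mem_scalarSubgroup hinj (l : H) hr
  Φ :=
    { toFun := fun r =>
        { val := fun h => coef r h
          inv := fun h => (coef r h)⁻¹
          val_inv := funext fun h => mul_inv_cancel₀ (coef_ne_zero hinj r h)
          inv_val := funext fun h => inv_mul_cancel₀ (coef_ne_zero hinj r h) }
      map_one' := Units.ext <| funext fun _ => coef_eq hinj (one_smul _ _).symm
      map_mul' := fun r s => Units.ext <| funext fun h => coef_mul hinj r s h }
  map_mul' r l h := coef_mul_apply hinj r l h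
  map_conj' r s := Units.ext <| funext fun h => (coef_conj hinj r s h).symm

variable (j : (scalarDatum hinj).NormalizedSection)

/-- The linear map `x # δ_h ↦ π(j(x) # δ_h)`. -/
def twistedSmashMap : QuotientDatum.TwistedSmash j →ₗ[k] L :=
  (QuotientDatum.TwistedSmash.basis j).constr k fun p => img π (j.toFun p.1) (p.2 : H)

theorem twistedSmashMap_basis (p : (Γ ⧸ (scalarDatum hinj).N) × (scalarDatum hinj).G) :
    twistedSmashMap hinj j (QuotientDatum.TwistedSmash.basis j p) =
      img π (j.toFun p.1) (p.2 : H) :=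
  Module.Basis.constr_basis _ _ _ _

theorem twistedSmashMap_one : twistedSmashMap hinj j 1 = 1 := by
  rw [QuotientDatum.TwistedSmash.one_def, map_sum, ← sum_img_one π]
  refine Fintype.sum_equiv Subgroup.topEquiv.toEquiv _ _ fun h => ?_
  rw [twistedSmashMap_basis, j.toFun_one]
  rfl

theorem twistedSmashMap_mul (a b : QuotientDatum.TwistedSmash j) :
    twistedSmashMap hinj j (a * b) = twistedSmashMap hinj j a * twistedSmashMap hinj j b := by
  classical
  suffices (LinearMap.mul k (QuotientDatum.TwistedSmash j)).compr₂ (twistedSmashMap hinj j) =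
      (LinearMap.mul k L).compl₁₂ (twistedSmashMap hinj j) (twistedSmashMap hinj j) from
    LinearMap.congr_fun (LinearMap.congr_fun this a) b
  refine (QuotientDatum.TwistedSmash.basis j).ext fun p =>
    (QuotientDatum.TwistedSmash.basis j).ext fun q => ?_
  change twistedSmashMap hinj j (_ * _) = twistedSmashMap hinj j _ * twistedSmashMap hinj j _
  rw [QuotientDatum.TwistedSmash.basis_mul_basis, twistedSmashMap_basis, twistedSmashMap_basis,
    img_mul_img]
  by_cases h : p.2 = q.2
  · rw [if_pos h, if_pos (congrArg Subtype.val h), map_smul, twistedSmashMap_basis]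
    exact (img_eq_smul_img (j.mul_mem p.1 q.1) (p.2 : H)).symm
  · rw [if_neg h, if_neg (fun h' => h (Subtype.ext h')), map_zero]

theorem counit_twistedSmashMap (a : QuotientDatum.TwistedSmash j) :
    Coalgebra.counit (R := k) (twistedSmashMap hinj j a) = Coalgebra.counit (R := k) a := by
  classical
  suffices Coalgebra.counit ∘ₗ twistedSmashMap hinj j =
      (Coalgebra.counit : QuotientDatum.TwistedSmash j →ₗ[k] k) from LinearMap.congr_fun this a
  refine (QuotientDatum.TwistedSmash.basis j).ext fun p => ?_
  rw [LinearMap.comp_apply, twistedSmashMap_basis, QuotientDatum.TwistedSmash.counit_eq,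
    QuotientDatum.TwistedSmash.counitMap_basis, counit_img]
  simp only [OneMemClass.coe_eq_one]

theorem comul_twistedSmashMap (a : QuotientDatum.TwistedSmash j) :
    TensorProduct.map (twistedSmashMap hinj j) (twistedSmashMap hinj j)
      (Coalgebra.comul (R := k) a) = Coalgebra.comul (twistedSmashMap hinj j a) := by
  suffices TensorProduct.map (twistedSmashMap hinj j) (twistedSmashMap hinj j) ∘ₗ
      Coalgebra.comul = Coalgebra.comul ∘ₗ twistedSmashMap hinj j from
    LinearMap.congr_fun this a
  refine (QuotientDatum.TwistedSmash.basis j).ext fun p => ?_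
  rw [LinearMap.comp_apply, LinearMap.comp_apply, twistedSmashMap_basis,
    QuotientDatum.TwistedSmash.comul_eq, QuotientDatum.TwistedSmash.comulMap_basis, comul_img,
    map_sum]
  -- The twisted coproduct has δ_{l⁻¹} in its left factor where the smash coproduct has δ_l, hence
  -- the reindexing by inversion.
  refine Fintype.sum_equiv ((Equiv.inv _).trans Subgroup.topEquiv.toEquiv) _ _ fun l => ?_
  rw [TensorProduct.map_tmul, map_smul, twistedSmashMap_basis, twistedSmashMap_basis]
  have h1 : (((Equiv.inv _).trans Subgroup.topEquiv.toEquiv) l : H) = (l : H)⁻¹ := rfl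
  rw [h1, inv_inv]
  exact congrArg _ (img_eq_smul_img (j.smul_mem l p.1) ((l : H) * (p.2 : H))).symm

theorem twistedSmashMap_injective : Function.Injective (twistedSmashMap hinj j) := by
  have hli : LinearIndependent k fun p : (Γ ⧸ (scalarDatum hinj).N) × H =>
      img π (j.toFun p.1) p.2 := by
    refine linearIndependent_img hinj (t := j.toFun) fun x y hxy => ?_
    have h1 : (j.toFun x * (j.toFun y)⁻¹ : Γ) ∈ (scalarDatum hinj).N := hxy
    rw [← QuotientGroup.eq_one_iff] at h1
    simpa [j.mk_toFun, mul_inv_eq_one] using h1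
  -- The basis of the twisted algebra is indexed by the subgroup `⊤` and not by `H` itself, so the
  -- family is pulled back along the inclusion.
  have hli' := hli.comp (Prod.map id Subtype.val :
    (Γ ⧸ (scalarDatum hinj).N) × (scalarDatum hinj).G → _)
    (Function.injective_id.prodMap Subtype.val_injective)
  rw [injective_iff_map_eq_zero]
  intro a ha
  rw [twistedSmashMap, Module.Basis.constr_apply] at ha
  exact (QuotientDatum.TwistedSmash.basis j).repr.map_eq_zero_iff.1
    (linearIndependent_iff.1 hli' _ ha)

theorem twistedSmashMap_surjective (hπ : Function.Surjective π) :
    Function.Surjective (twistedSmashMap hinj j) := by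
  have h1 : ⊤ ≤ (LinearMap.range (twistedSmashMap hinj j)).comap
      (π : SmashCoproduct k Γ H →ₗ[k] L) := by
    rw [← (basis k Γ H).span_eq, Submodule.span_le]
    rintro _ ⟨⟨r, h⟩, rfl⟩
    -- Since `r` and the representative of its class differ by an element of N, the image of `r #
    -- δ_h` is a multiple of the image of a basis vector.
    have hr : r * (j.toFun (r : Γ ⧸ (scalarDatum hinj).N))⁻¹ ∈ (scalarDatum hinj).N := by
      rw [← QuotientGroup.eq_one_iff]
      simp [j.mk_toFun]
    refine ⟨coef ⟨_, hr⟩ h • QuotientDatum.TwistedSmash.basis j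
      ((r : Γ ⧸ (scalarDatum hinj).N), ⟨h, Subgroup.mem_top h⟩), ?_⟩
    rw [map_smul, twistedSmashMap_basis]
    exact (img_eq_smul_img hr h).symm
  intro y
  obtain ⟨x, rfl⟩ := hπ y
  exact h1 (Submodule.mem_top (x := x))

/-- A surjective Hopf algebra map which is injective on `k^H` identifies its target with
the Hopf algebra of its quotient datum. -/
def twistedSmashEquiv (hπ : Function.Surjective π) :
    QuotientDatum.TwistedSmash j ≃ₐc[k] L :=
  -- Antipodes need no check: an isomorphism of bialgebras between Hopf algebras preserves them.
  BialgEquiv.ofAlgEquiv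
    (AlgEquiv.ofBijective (AlgHom.ofLinearMap (twistedSmashMap hinj j)
      (twistedSmashMap_one hinj j) (twistedSmashMap_mul hinj j))
      ⟨twistedSmashMap_injective hinj j, twistedSmashMap_surjective hinj j hπ⟩)
    (AlgHom.ext (counit_twistedSmashMap hinj j)) (AlgHom.ext (comul_twistedSmashMap hinj j))

end SmashCoproduct
end

/-- Let `π : k[Γ] ⋊ k^H → L` be a surjective Hopf algebra map which is injective on `k^H`. Then
there is a quotient datum `(H, N, Φ)` such that `N` is the set of all `r ∈ Γ` with
`π(r # 1) = π(1 # f)` for some `f ∈ (k^H)ˣ`, such that for `r ∈ N` the unique such `f` is `Φ(r)`,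
and such that `k[Γ/N] ⋊_Φ k^H`, constructed with any section `j`, is isomorphic to `L`. -/
theorem proposition2p6 {k Γ H L : Type*} [Field k] [Group Γ] [Group H] [Finite H]
    [MulDistribMulAction H Γ] [Ring L] [HopfAlgebra k L]
    (π : SmashCoproduct k Γ H →ₐc[k] L) (hπ : Function.Surjective π)
    (hinj : Function.Injective fun f : H → k => π (SmashCoproduct.tmul (1 : Γ) f)) :
    ∃ D : QuotientDatum k Γ H,
      D.G = ⊤ ∧
      (∀ r : Γ, r ∈ D.N ↔ ∃ f : (H → k)ˣ,
        π (SmashCoproduct.tmul r 1) = π (SmashCoproduct.tmul 1 (f : H → k))) ∧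
      (∀ r : D.N, ∃ f : (H → k)ˣ,
        (∀ g : (H → k)ˣ,
          π (SmashCoproduct.tmul (r : Γ) 1) = π (SmashCoproduct.tmul 1 (g : H → k)) ↔ g = f) ∧
        ∀ h : D.G, (D.Φ r : D.G → k) h = (f : H → k) h) ∧
      ∀ j : D.NormalizedSection, Nonempty (D.TwistedSmash j ≃ₐc[k] L) := by
  refine ⟨SmashCoproduct.scalarDatum hinj, rfl,
    fun r => SmashCoproduct.mem_scalarSubgroup_iff_exists_unit hinj, fun r => ?_,
    fun j => ⟨SmashCoproduct.twistedSmashEquiv hinj j hπ⟩⟩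
  obtain ⟨f, hf⟩ := (SmashCoproduct.mem_scalarSubgroup_iff_exists_unit hinj).1 r.2
  -- Uniqueness of `f` is injectivity on k^H; its agreement with Φ(r) is the uniqueness of the
  -- scalar in each component.
  refine ⟨f, fun g => ⟨fun hg => Units.ext (hinj (hg.symm.trans hf)), fun hg => hg ▸ hf⟩,
    fun h => SmashCoproduct.coef_eq hinj (SmashCoproduct.map_tmul_one_eq_iff.1 hf h)⟩
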